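/- There exist universal constants $c, C > 0$ such that the following holds. Let $1 \le r \le d$ and $n \ge 1$ be integers, let $z_1,\dots,z_d$ be complex numbers of modulus one with $$\Delta_z := \min_{1\le i\le r,\ 1\le i'\le d,\ i\ne i'} |z_i - z_{i'}| > 0$$ ($\Delta_z := +\infty$ and $1/\Delta_z := 0$ if $r = d = 1$), and let $\mu_1,\dots,\mu_r > 0$. Write $z_{\mathrm{dom}} = (z_1,\dots,z_r)$, let $V_n(z_{\mathrm{dom}}) \in \mathbb{C}^{n\times r}$ be the Vandermonde matrix whose $i$-th column is $(1, z_i, z_i^2, \dots, z_i^{n-1})^\top$, and let $$T = V_n(z_{\mathrm{dom}})\,\mathrm{diag}(\mu_1,\dots,\mu_r)\,V_n(z_{\mathrm{dom}})^\dagger .$$ Assume $n \ge c/\Delta_z$. Then $r \le n$, and for every eigenvalue decomposition $T = Q\Sigma Q^\dagger$ with $Q$ unitary and $\Sigma$ real diagonal with diagonal entries in non-increasing order, the matrix $Q_r$ of the first $r$ columns of $Q$ has the following property. There is a unique matrix $P_v \in \mathbb{C}^{r\times r}$ with $$Q_r = \frac{1}{\sqrt n}\, V_n(z_{\mathrm{dom}})\,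 P_v ,$$ it is invertible, and it is nearly unitary: in the $\ell_2\to\ell_2$ operator norm, $$\|P_v^\dagger P_v - I_r\|_2 = \|P_v P_v^\dagger - I_r\|_2 \le \frac{C}{\Delta_z n}, \qquad \|P_v\|_2 \le C, \qquad \|P_v^{-1}\|_2 \le C .$$ -/

import Mathlib

/- `‖A‖` for a complex matrix `A` is the `ℓ₂ → ℓ₂` operator norm. -/
open scoped Matrix Matrix.Norms.L2Operator ENNReal

namespace Esprit

/-- The dominant locations `(z₁, …, z_r)` among all the locations `(z₁, …, z_d)`. -/
def zdom {r d : ℕ} (hrd : r ≤ d) (z : Fin d → Circle) : Fin r → Circle :=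
  fun i => z (Fin.castLE hrd i)

/-- The gap `Δ_z = min |z_i - z_i'|` over `1 ≤ i ≤ r`, `1 ≤ i' ≤ d`, `i ≠ i'`. It takes values in
`[0, ∞]`, and it is `∞` exactly when there is no such pair (for `r ≥ 1`: when `r = d = 1`). -/
noncomputable def gap (r : ℕ) {d : ℕ} (z : Fin d → Circle) : ℝ≥0∞ :=
  ⨅ (i : Fin d) (i' : Fin d) (_ : (i : ℕ) < r) (_ : i ≠ i'), edist (z i : ℂ) (z i' : ℂ)

/-- The `n × k` Vandermonde matrix whose columns are `(1, z_i, z_i², …, z_i^(n-1))ᵀ`. -/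
noncomputable def vander (n : ℕ) {k : ℕ} (z : Fin k → Circle) : Matrix (Fin n) (Fin k) ℂ :=
  Matrix.of fun j i => (z i : ℂ) ^ (j : ℕ)

/-- The Toeplitz matrix `V_n(z) diag(μ) V_n(z)†` of the exact signal. -/
noncomputable def toeplitz (n : ℕ) {k : ℕ} (z : Fin k → Circle) (μ : Fin k → ℝ) :
    Matrix (Fin n) (Fin n) ℂ :=
  vander n z * Matrix.diagonal (fun i => (μ i : ℂ)) * (vander n z)ᴴ

/-- `T = Q diag(lam) Q†` is an eigenvalue decomposition of `T`: `Q` is unitary and the real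
eigenvalues `lam` are listed in decreasing order. -/
structure IsEigendecomposition {n : ℕ} (T Q : Matrix (Fin n) (Fin n) ℂ) (lam : Fin n → ℝ) :
    Prop where
  unitary : Q ∈ Matrix.unitaryGroup (Fin n) ℂ
  decreasing : Antitone lam
  eq : T = Q * Matrix.diagonal (fun i => (lam i : ℂ)) * Qᴴ

/-- `Q_r`, the first `r` columns of `Q`. -/
def firstCols {n r : ℕ} (hrn : r ≤ n) (Q : Matrix (Fin n) (Fin n) ℂ) : Matrix (Fin n) (Fin r) ℂ :=
  Q.submatrix id (Fin.castLE hrn)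

end Esprit

/-! Put `A = V_n(z_dom)/√n` and `G = A†A`. Everything reduces to `‖G - 1‖ ≤ ε` with `ε = O(1/(Δ_z
n))` and `ε ≤ 1/2`. Indeed `T = A diag(nμ) A†` has at least `r` positive eigenvalues and its range
lies in that of `A`, so `Q_r = A P`. Orthonormality of the columns of `Q_r` reads `P†GP = 1`, that
is `PP† = G⁻¹`, and the bounds on `P` follow from those on `G` (`exists_nearly_unitary`).

The bound on `G` is a two-sided large sieve, `∑_{k<n} |∑ a_i z_i^k|² = (n + O(1/δ)) ∑ |a_i|²`
(`abs_sum_expSum_sub_le`). Expanding the square directly gives off-diagonal terms of order `1/|z_i -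
z_j|`, whose absolute row sums can cost a logarithm. Summing over windows of length `L ≈ 1/δ` turns
the kernel into a product of two geometric sums, of order `1/|z_i - z_j|²`, with row sums `O(1/δ²)`
(`sum_inv_sq_dist_le`). Schur's test bounds the error, and dividing by `L` leaves `O(1/δ)`. -/

namespace Esprit

/-! ### Repulsion of separated points on the circle. -/

/-- The series `∑ 1 / (1 + m²)` over the integers. -/
noncomputable def latticeSum : ℝ := ∑' m : ℤ, (1 + (m : ℝ) ^ 2)⁻¹

lemma summable_inv_one_add_sq : Summable fun m : ℤ => (1 + (m : ℝ) ^ 2)⁻¹ := by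
  have h : Summable fun m : ℤ => (1 : ℝ) / (m : ℝ) ^ 2 :=
    Real.summable_one_div_int_pow.2 (by norm_num)
  refine h.of_norm_bounded_eventually ?_
  have : ∀ᶠ m : ℤ in Filter.cofinite, m ≠ 0 := by
    rw [Filter.eventually_cofinite]
    simp
  filter_upwards [this] with m hm
  have hm' : (0 : ℝ) < (m : ℝ) ^ 2 := by positivity
  rw [Real.norm_of_nonneg (by positivity), one_div]
  gcongr
  linarith

lemma latticeSum_nonneg : 0 ≤ latticeSum := tsum_nonneg fun m => by positivity

lemma norm_exp_sub_exp_le (x y : ℝ) :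
    ‖(Circle.exp x : ℂ) - Circle.exp y‖ ≤ |x - y| := by
  have h : (Circle.exp x : ℂ) - Circle.exp y =
      Circle.exp y * (Complex.exp (Complex.I * ((x - y : ℝ) : ℂ)) - 1) := by
    rw [mul_sub, Circle.coe_exp, Circle.coe_exp, ← Complex.exp_add, mul_one]
    congr 2
    push_cast
    ring
  rw [h, norm_mul, Circle.norm_coe, one_mul]
  exact Real.norm_exp_I_mul_ofReal_sub_one_le

/-- Since `|⌊t⌋| ≤ |t| + 1 ≤ 2|t|`, one has `1 + ⌊t⌋² ≤ 5t²`. -/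
lemma inv_sq_le_of_floor {t : ℝ} (ht : 1 ≤ |t|) :
    (t ^ 2)⁻¹ ≤ 5 * (1 + ((⌊t⌋ : ℤ) : ℝ) ^ 2)⁻¹ := by
  have h1 := Int.floor_le t
  have h2 := Int.lt_floor_add_one t
  have h3 : |(⌊t⌋ : ℝ)| ≤ |t| + 1 := by
    have : |(⌊t⌋ : ℝ) - t| ≤ 1 := abs_le.2 ⟨by linarith, by linarith⟩
    have := abs_sub_abs_le_abs_sub (⌊t⌋ : ℝ) t
    linarith
  have h4 : ((⌊t⌋ : ℤ) : ℝ) ^ 2 ≤ (|t| + 1) ^ 2 := by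
    rw [← sq_abs]
    gcongr
  have h5 : |t| ^ 2 = t ^ 2 := sq_abs t
  have h6 : 0 < t ^ 2 := by nlinarith
  rw [← div_eq_mul_inv, inv_eq_one_div, div_le_div_iff₀ h6 (by positivity)]
  nlinarith

/-- Points on the circle with pairwise distances at least `δ` repel: the inverse square distances
to any one of them sum to `O(1 / δ²)`. -/
lemma sum_inv_sq_dist_le {ι : Type*} [Fintype ι] [DecidableEq ι] (z : ι → Circle) {δ : ℝ} (hδ : 0 < δ)
    (hz : ∀ i j, i ≠ j → δ ≤ ‖(z i : ℂ) - z j‖) (i : ι) :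
    ∑ j ∈ Finset.univ.erase i, (‖(z i : ℂ) - z j‖ ^ 2)⁻¹ ≤
      5 * Real.pi ^ 2 / 4 * latticeSum / δ ^ 2 := by
  -- Angles are measured from `z i`. Chord ≤ arc transfers separation to the angles; arc ≤ (π/2) ·
  -- chord bounds the inverse chords by inverse angles.
  let θ : ι → ℝ := fun j => Complex.arg ((z j / z i : Circle) : ℂ)
  have hexp : ∀ j, z j = z i * Circle.exp (θ j) := fun j => by
    rw [Circle.exp_arg, mul_div_cancel]
  have hdist : ∀ j k, ‖(z j : ℂ) - z k‖ ≤ |θ j - θ k| := fun j k => by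
    rw [hexp j, hexp k, Circle.coe_mul, Circle.coe_mul, ← mul_sub, norm_mul, Circle.norm_coe,
      one_mul]
    exact norm_exp_sub_exp_le _ _
  have hθi : θ i = 0 := by simp [θ]
  have habs : ∀ j, j ≠ i → δ ≤ |θ j| := fun j hj => by
    have := (hz j i hj).trans (hdist j i)
    rwa [hθi, sub_zero] at this
  have hlow : ∀ j, |θ j| ≤ Real.pi / 2 * ‖(z i : ℂ) - z j‖ := fun j => by
    have h := Complex.angle_le_mul_norm_sub (x := ((z j / z i : Circle) : ℂ)) (y := 1)
      (Circle.norm_coe _) (by simp)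
    rw [InnerProductGeometry.angle, ← InnerProductGeometry.angle, Complex.angle_one_right
      (Circle.coe_ne_zero _)] at h
    refine h.trans_eq ?_
    have : ((z j : ℂ) - z i) = z i * (((z j / z i : Circle) : ℂ) - 1) := by
      rw [mul_sub, ← Circle.coe_mul, mul_div_cancel, mul_one]
    rw [norm_sub_rev (z i : ℂ), this, norm_mul, Circle.norm_coe, one_mul]
  -- Angles are `δ`-separated, so each cell of length `δ` holds at most one point; this permits
  -- comparison with the lattice sum.
  have hinj : Set.InjOn (fun j => ⌊θ j / δ⌋) (Finset.univ.erase i : Finset ι) := by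
    intro j _ k _ hjk
    by_contra hne
    have h1 := Int.abs_sub_lt_one_of_floor_eq_floor hjk
    rw [← sub_div, abs_div, abs_of_pos hδ, div_lt_one hδ] at h1
    exact absurd ((hz j k hne).trans (hdist j k)) (not_le.2 h1)
  have hterm : ∀ j ∈ Finset.univ.erase i, (‖(z i : ℂ) - z j‖ ^ 2)⁻¹ ≤
      5 * Real.pi ^ 2 / 4 / δ ^ 2 * (1 + ((⌊θ j / δ⌋ : ℤ) : ℝ) ^ 2)⁻¹ := by
    intro j hj
    have hj' : j ≠ i := Finset.ne_of_mem_erase hj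
    have hθ := habs j hj'
    have hθ0 : 0 < |θ j| := hδ.trans_le hθ
    have h1 : 1 ≤ |θ j / δ| := by rwa [abs_div, abs_of_pos hδ, one_le_div hδ]
    have h2 := inv_sq_le_of_floor h1
    have hpi := Real.pi_pos
    have h3 : |θ j| ^ 2 ≤ (Real.pi / 2 * ‖(z i : ℂ) - z j‖) ^ 2 := by
      gcongr
      exact hlow j
    have hd : 0 < ‖(z i : ℂ) - z j‖ ^ 2 := by
      have := hδ.trans_le (hz i j hj'.symm)
      positivity
    calc (‖(z i : ℂ) - z j‖ ^ 2)⁻¹ ≤ Real.pi ^ 2 / 4 / δ ^ 2 * ((θ j / δ) ^ 2)⁻¹ := by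
          rw [← sq_abs (θ j / δ), abs_div, abs_of_pos hδ]
          have : Real.pi ^ 2 / 4 / δ ^ 2 * ((|θ j| / δ) ^ 2)⁻¹ = Real.pi ^ 2 / 4 / |θ j| ^ 2 := by
            field_simp
          rw [this, inv_eq_one_div, div_le_div_iff₀ hd (by positivity)]
          linarith
      _ ≤ Real.pi ^ 2 / 4 / δ ^ 2 * (5 * (1 + ((⌊θ j / δ⌋ : ℤ) : ℝ) ^ 2)⁻¹) := by gcongr
      _ = _ := by ring
  calc _ ≤ ∑ j ∈ Finset.univ.erase i,
        5 * Real.pi ^ 2 / 4 / δ ^ 2 * (1 + ((⌊θ j / δ⌋ : ℤ) : ℝ) ^ 2)⁻¹ := Finset.sum_le_sum hterm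
    _ = 5 * Real.pi ^ 2 / 4 / δ ^ 2 *
        ∑ m ∈ (Finset.univ.erase i).image (fun j => ⌊θ j / δ⌋), (1 + (m : ℝ) ^ 2)⁻¹ := by
        rw [← Finset.mul_sum, Finset.sum_image hinj]
    _ ≤ 5 * Real.pi ^ 2 / 4 / δ ^ 2 * latticeSum := by
        gcongr
        exact summable_inv_one_add_sq.sum_le_tsum _ fun m _ => by positivity
    _ = _ := by ring

/-! ### The large sieve by averaging over windows. -/

/-- The exponential sum `∑ a_i z_i^k`. -/
noncomputable def expSum {ι : Type*} [Fintype ι] (z : ι → Circle) (a : ι → ℂ) (k : ℕ) : ℂ :=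
  ∑ i, a i * (z i : ℂ) ^ k

lemma norm_geom_sum_le (w : Circle) (hw : w ≠ 1) (N : ℕ) :
    ‖∑ k ∈ Finset.range N, (w : ℂ) ^ k‖ ≤ 2 / ‖(w : ℂ) - 1‖ := by
  have hw' : (w : ℂ) ≠ 1 := fun h => hw (by ext; simpa using h)
  rw [geom_sum_eq hw', norm_div]
  gcongr
  refine (norm_sub_le _ _).trans ?_
  rw [norm_pow, Circle.norm_coe, one_pow, norm_one]
  norm_num

lemma sum_window_eq {ι : Type*} [Fintype ι] (z : ι → Circle) (a : ι → ℂ) (N L : ℕ) :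
    ((∑ x ∈ Finset.range N, ∑ y ∈ Finset.range L, ‖expSum z a (x + y)‖ ^ 2 : ℝ) : ℂ) =
      ∑ i, ∑ j, a i * star (a j) *
        ((∑ x ∈ Finset.range N, ((z i / z j : Circle) : ℂ) ^ x) *
          ∑ y ∈ Finset.range L, ((z i / z j : Circle) : ℂ) ^ y) := by
  have h : ∀ k, ((‖expSum z a k‖ ^ 2 : ℝ) : ℂ) =
      ∑ i, ∑ j, a i * star (a j) * ((z i / z j : Circle) : ℂ) ^ k := by
    intro k
    rw [Complex.ofReal_pow, ← Complex.mul_conj', expSum, map_sum, Finset.sum_mul_sum]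
    refine Finset.sum_congr rfl fun i _ => Finset.sum_congr rfl fun j _ => ?_
    rw [div_eq_mul_inv, Circle.coe_mul, Circle.coe_inv_eq_conj, mul_pow, map_mul, map_pow]
    simp only [Complex.star_def]
    ring
  simp_rw [Complex.ofReal_sum, h, Finset.sum_mul_sum, Finset.mul_sum, ← pow_add]
  rw [Finset.sum_congr rfl fun x _ => Finset.sum_comm, Finset.sum_comm]
  refine Finset.sum_congr rfl fun i _ => ?_
  rw [Finset.sum_congr rfl fun x _ => Finset.sum_comm, Finset.sum_comm]

/-- Schur's test for a symmetric kernel without diagonal. -/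
lemma sum_offDiag_le {ι : Type*} [Fintype ι] [DecidableEq ι] (b : ι → ℝ) (K : ι → ι → ℝ) (hK : ∀ i j, 0 ≤ K i j)
    (hsymm : ∀ i j, K i j = K j i) {R : ℝ}
    (hR : ∀ i, ∑ j ∈ Finset.univ.erase i, K i j ≤ R) :
    ∑ i, ∑ j ∈ Finset.univ.erase i, b i * b j * K i j ≤ R * ∑ i, b i ^ 2 := by
  have hswap : ∑ i, ∑ j ∈ Finset.univ.erase i, b j ^ 2 * K i j =
      ∑ i, ∑ j ∈ Finset.univ.erase i, b i ^ 2 * K i j := by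
    rw [Finset.sum_comm' (t' := Finset.univ) (s' := fun j => Finset.univ.erase j)
      (by simp [ne_comm])]
    simp_rw [fun i j => hsymm j i]
  calc _ ≤ ∑ i, ∑ j ∈ Finset.univ.erase i, ((b i ^ 2 * K i j) / 2 + (b j ^ 2 * K i j) / 2) := by
        gcongr with i _ j _
        nlinarith [mul_nonneg (sq_nonneg (b i - b j)) (hK i j)]
    _ = ∑ i, b i ^ 2 * ∑ j ∈ Finset.univ.erase i, K i j := by
        simp_rw [Finset.sum_add_distrib, ← Finset.sum_div, hswap, add_halves, Finset.mul_sum]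
    _ ≤ ∑ i, b i ^ 2 * R := by
        gcongr with i _
        exact hR i
    _ = _ := by rw [← Finset.sum_mul, mul_comm]

/-- The diagonal of the expanded square contributes exactly `N L ∑ |a_i|²`. Off the diagonal each of
the two geometric sums is at most `2/|z_i - z_j|`, and Schur's test applies. -/
lemma abs_sum_window_sub_le {ι : Type*} [Fintype ι] [DecidableEq ι] (z : ι → Circle)
    (a : ι → ℂ) (N L : ℕ) (hz : Function.Injective z)
    {R : ℝ} (hR : ∀ i, ∑ j ∈ Finset.univ.erase i, (‖(z i : ℂ) - z j‖ ^ 2)⁻¹ ≤ R) :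
    |∑ x ∈ Finset.range N, ∑ y ∈ Finset.range L, ‖expSum z a (x + y)‖ ^ 2 -
      N * L * ∑ i, ‖a i‖ ^ 2| ≤ 4 * R * ∑ i, ‖a i‖ ^ 2 := by
  have hsplit : ((∑ x ∈ Finset.range N, ∑ y ∈ Finset.range L, ‖expSum z a (x + y)‖ ^ 2 -
      N * L * ∑ i, ‖a i‖ ^ 2 : ℝ) : ℂ) =
      ∑ i, ∑ j ∈ Finset.univ.erase i, a i * star (a j) *
        ((∑ x ∈ Finset.range N, ((z i / z j : Circle) : ℂ) ^ x) *
          ∑ y ∈ Finset.range L, ((z i / z j : Circle) : ℂ) ^ y) := by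
    rw [Complex.ofReal_sub, sum_window_eq, sub_eq_iff_eq_add]
    simp only [Complex.ofReal_mul, Complex.ofReal_sum, Complex.ofReal_natCast, Complex.ofReal_pow]
    rw [Finset.mul_sum, ← Finset.sum_add_distrib]
    refine Finset.sum_congr rfl fun i _ => ?_
    rw [← Finset.sum_erase_add _ _ (Finset.mem_univ i)]
    congr 1
    simp only [div_self', Circle.coe_one, one_pow, Finset.sum_const, Finset.card_range,
      nsmul_eq_mul, mul_one, Complex.star_def, Complex.mul_conj']
    ring
  rw [← Real.norm_eq_abs, ← Complex.norm_real, hsplit]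
  refine (norm_sum_le _ _).trans ?_
  refine (Finset.sum_le_sum fun i _ => norm_sum_le _ _).trans ?_
  refine le_trans (Finset.sum_le_sum fun i _ => Finset.sum_le_sum fun j hj => ?_)
    (sum_offDiag_le (fun i => ‖a i‖) (fun i j => 4 * (‖(z i : ℂ) - z j‖ ^ 2)⁻¹)
      (fun i j => by positivity) (fun i j => by rw [norm_sub_rev]) (R := 4 * R) fun i => ?_)
  · have hne : z i / z j ≠ 1 := fun h =>
      Finset.ne_of_mem_erase hj (hz (div_eq_one.1 h)).symm
    have hnorm : ‖((z i / z j : Circle) : ℂ) - 1‖ = ‖(z i : ℂ) - z j‖ := by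
      have : (z i : ℂ) - z j = z j * (((z i / z j : Circle) : ℂ) - 1) := by
        rw [mul_sub, ← Circle.coe_mul, mul_div_cancel, mul_one]
      rw [this, norm_mul, Circle.norm_coe, one_mul]
    rw [norm_mul, norm_mul, norm_mul, norm_star]
    refine mul_le_mul_of_nonneg_left ?_ (by positivity)
    calc _ ≤ 2 / ‖(z i : ℂ) - z j‖ * (2 / ‖(z i : ℂ) - z j‖) := by
          rw [← hnorm]
          gcongr <;> exact norm_geom_sum_le _ hne _
      _ = _ := by
        rw [div_mul_div_comm, ← sq ‖_‖, div_eq_mul_inv]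
        norm_num
  · rw [← Finset.mul_sum]
    linarith [hR i]

/-- The twist is unimodular, so `∑ |a_i|²` is unchanged: the range `[0, n)` can be moved to `[L, n +
L)` at no cost. -/
lemma expSum_shift {ι : Type*} [Fintype ι] (z : ι → Circle) (a : ι → ℂ) (L k : ℕ) :
    expSum z (fun i => a i * ((z i : ℂ) ^ L)⁻¹) (k + L) = expSum z a k := by
  refine Finset.sum_congr rfl fun i _ => ?_
  have := Circle.coe_ne_zero (z i)
  rw [pow_add]
  field_simp

/-- For each `y < L` the translate `[y, y + N)` lies inside `[0, n)`. -/
lemma sum_window_le (f : ℕ → ℝ) (hf : ∀ k, 0 ≤ f k) {n N L : ℕ} (h : N + L ≤ n + 1) :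
    ∑ x ∈ Finset.range N, ∑ y ∈ Finset.range L, f (x + y) ≤
      L * ∑ k ∈ Finset.range n, f k := by
  rw [Finset.sum_comm, ← nsmul_eq_mul]
  nth_rewrite 2 [← Finset.card_range L]
  refine Finset.sum_le_card_nsmul _ _ _ fun y hy => ?_
  rw [Finset.mem_range] at hy
  rw [← Finset.sum_image (g := fun x => x + y) (fun a _ b _ h => Nat.add_right_cancel h)]
  refine Finset.sum_le_sum_of_subset_of_nonneg ?_ fun _ _ _ => hf _
  intro k
  simp only [Finset.mem_image, Finset.mem_range]
  omega

/-- For each `y < L` the translate `[y, y + n + L)` contains `[L, n + L)`. -/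
lemma le_sum_window (f : ℕ → ℝ) (hf : ∀ k, 0 ≤ f k) (n L : ℕ) :
    L * ∑ k ∈ Finset.range n, f (k + L) ≤
      ∑ x ∈ Finset.range (n + L), ∑ y ∈ Finset.range L, f (x + y) := by
  rw [Finset.sum_comm (s := Finset.range (n + L)), ← nsmul_eq_mul]
  nth_rewrite 1 [← Finset.card_range L]
  refine Finset.card_nsmul_le_sum _ _ _ fun y hy => ?_
  rw [Finset.mem_range] at hy
  rw [← Finset.sum_image (g := fun x => x + y) (fun a _ b _ h => Nat.add_right_cancel h),
    ← Finset.sum_image (g := fun x => x + L) (fun a _ b _ h => Nat.add_right_cancel h)]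
  refine Finset.sum_le_sum_of_subset_of_nonneg ?_ fun _ _ _ => hf _
  intro k
  simp only [Finset.mem_image, Finset.mem_range]
  rintro ⟨m, hm, rfl⟩
  exact ⟨m + L - y, by omega, by omega⟩

/-- The constant of the large sieve type inequality below. -/
noncomputable def sieveConst : ℝ := 3 + 5 * Real.pi ^ 2 * latticeSum

lemma three_le_sieveConst : 3 ≤ sieveConst := by
  have := latticeSum_nonneg
  have : 0 ≤ 5 * Real.pi ^ 2 * latticeSum := by positivity
  rw [sieveConst]
  linarith

/-- Two-sided large sieve inequality for exponential sums with `δ`-separated frequencies. -/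
lemma abs_sum_expSum_sub_le {ι : Type*} [Fintype ι] [DecidableEq ι] (z : ι → Circle) {δ : ℝ}
    (hδ : 0 < δ) (hδ2 : δ ≤ 2)
    (hz : ∀ i j, i ≠ j → δ ≤ ‖(z i : ℂ) - z j‖) {n : ℕ} (hn : 3 / δ ≤ n) (a : ι → ℂ) :
    |∑ k ∈ Finset.range n, ‖expSum z a k‖ ^ 2 - n * ∑ i, ‖a i‖ ^ 2| ≤
      sieveConst / δ * ∑ i, ‖a i‖ ^ 2 := by
  have hinj : Function.Injective z := fun i j h => by
    by_contra hne
    have := hz i j hne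
    rw [h, sub_self, norm_zero] at this
    linarith
  -- `L = ⌈1/δ⌉`; the rounding costs at most `1 ≤ 2/δ`, because `δ ≤ 2`.
  obtain ⟨L, hL1, hL3⟩ : ∃ L : ℕ, 1 / δ ≤ L ∧ (L : ℝ) ≤ 3 / δ := by
    refine ⟨⌈1 / δ⌉₊, Nat.le_ceil _, ?_⟩
    have h := (Nat.ceil_lt_add_one (by positivity : 0 ≤ 1 / δ)).le
    have h2 : 1 ≤ 2 / δ := by rwa [one_le_div hδ]
    calc _ ≤ 1 / δ + 1 := h
      _ ≤ 1 / δ + 2 / δ := by gcongr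
      _ = 3 / δ := by ring
  have hL0 : (0 : ℝ) < L := lt_of_lt_of_le (by positivity) hL1
  have hLn : L ≤ n := by exact_mod_cast hL3.trans hn
  have hR := sum_inv_sq_dist_le z hδ hz
  set E := ∑ i, ‖a i‖ ^ 2 with hE
  have hE0 : 0 ≤ E := Finset.sum_nonneg fun i _ => by positivity
  -- `L ≥ 1/δ` absorbs one factor `1/δ` of the Schur error; `L ≤ 3/δ` supplies the `3` in
  -- `sieveConst`.
  have herr : 4 * (5 * Real.pi ^ 2 / 4 * latticeSum / δ ^ 2) * E ≤
      L * (5 * Real.pi ^ 2 * latticeSum / δ * E) := by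
    have := latticeSum_nonneg
    calc _ = 1 / δ * (5 * Real.pi ^ 2 * latticeSum / δ * E) := by field_simp
      _ ≤ _ := by gcongr
  have hconst : sieveConst / δ * E = 3 / δ * E + 5 * Real.pi ^ 2 * latticeSum / δ * E := by
    rw [sieveConst]
    ring
  have hLE : L * E ≤ 3 / δ * E := by gcongr
  have hsq : ∀ b : ι → ℂ, ∀ k, 0 ≤ ‖expSum z b k‖ ^ 2 := fun b k => by positivity
  rw [abs_le, hconst]
  constructor
  -- Lower bound: `n + 1 - L` is the number of windows of length `L` inside `[0, n)`.
  · have h1 := (abs_le.1 (abs_sum_window_sub_le z a (n + 1 - L) L hinj hR)).1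
    have h2 := sum_window_le _ (hsq a) (n := n) (N := n + 1 - L) (L := L) (by omega)
    have hcast : ((n + 1 - L : ℕ) : ℝ) = n + 1 - L := by
      rw [Nat.cast_sub (by omega)]
      push_cast
      ring
    rw [hcast] at h1
    have h3 : (L : ℝ) * ((n + 1 - L) * E - 5 * Real.pi ^ 2 * latticeSum / δ * E) ≤
        L * ∑ k ∈ Finset.range n, ‖expSum z a k‖ ^ 2 := by
      linarith
    have h4 := le_of_mul_le_mul_left h3 hL0
    linarith
  -- Upper bound: `n + L` windows cover the shifted range `[L, n + L)` fully, `L` times over.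
  · let a' : ι → ℂ := fun i => a i * ((z i : ℂ) ^ L)⁻¹
    have hE' : ∑ i, ‖a' i‖ ^ 2 = E := by simp [a', hE, Circle.norm_coe]
    have h1 := (abs_le.1 (abs_sum_window_sub_le z a' (n + L) L hinj hR)).2
    have h2 := le_sum_window _ (hsq a') n L
    simp only [a', expSum_shift] at h2
    rw [hE'] at h1
    push_cast at h1
    have h3 : L * ∑ k ∈ Finset.range n, ‖expSum z a k‖ ^ 2 ≤
        (L : ℝ) * ((n + L) * E + 5 * Real.pi ^ 2 * latticeSum / δ * E) := by
      linarith
    have h4 := le_of_mul_le_mul_left h3 hL0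
    linarith

/-! ### Operator norms of Hermitian matrices and of inverses near the identity. -/

lemma l2_opNorm_le_of_abs_re_le {ι : Type*} [Fintype ι] [DecidableEq ι] {M : Matrix ι ι ℂ}
    (hM : M.IsHermitian) {ε : ℝ} (hε : 0 ≤ ε)
    (h : ∀ x : ι → ℂ, |(star x ⬝ᵥ M *ᵥ x).re| ≤ ε * ∑ i, ‖x i‖ ^ 2) : ‖M‖ ≤ ε := by
  rw [Matrix.cstar_norm_def]
  have hsymm : (Matrix.toEuclideanCLM (n := ι) (𝕜 := ℂ) M).IsSymmetric :=
    Matrix.isSymmetric_toEuclideanLin_iff.2 hM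
  rw [ContinuousLinearMap.norm_eq_iSup_rayleighQuotient _ hsymm]
  refine Real.iSup_le (fun x => ?_) hε
  rw [ContinuousLinearMap.rayleighQuotient, abs_div, abs_sq]
  refine div_le_of_le_mul₀ (by positivity) hε ?_
  rw [EuclideanSpace.norm_sq_eq]
  refine le_of_eq_of_le (congrArg abs ?_) (h x.ofLp)
  rw [ContinuousLinearMap.reApplyInnerSelf_apply, ← inner_conj_symm, RCLike.conj_re,
    EuclideanSpace.inner_eq_star_dotProduct, dotProduct_comm]
  simp

/-- `P†P - 1` and `PP† - 1` have the same norm, as they are similar Hermitian matrices. -/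
lemma norm_conjTranspose_mul_self_sub_one {ι : Type*} [Fintype ι] [DecidableEq ι]
    {P : Matrix ι ι ℂ} (hP : IsUnit P) : ‖Pᴴ * P - 1‖ = ‖P * Pᴴ - 1‖ := by
  obtain ⟨u, rfl⟩ := hP
  have h1 : IsSelfAdjoint ((u : Matrix ι ι ℂ)ᴴ * u - 1) :=
    (IsSelfAdjoint.star_mul_self (u : Matrix ι ι ℂ)).sub (IsSelfAdjoint.one _)
  have h2 : IsSelfAdjoint ((u : Matrix ι ι ℂ) * (u : Matrix ι ι ℂ)ᴴ - 1) :=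
    (IsSelfAdjoint.mul_star_self (u : Matrix ι ι ℂ)).sub (IsSelfAdjoint.one _)
  have h3 : (u : Matrix ι ι ℂ) * (u : Matrix ι ι ℂ)ᴴ - 1 =
      u * ((u : Matrix ι ι ℂ)ᴴ * u - 1) * ((u⁻¹ : (Matrix ι ι ℂ)ˣ) : Matrix ι ι ℂ) := by
    simp [mul_sub, sub_mul, mul_assoc]
  have h4 := h1.spectralRadius_eq_nnnorm
  have h5 := h2.spectralRadius_eq_nnnorm
  have h6 : spectralRadius ℂ ((u : Matrix ι ι ℂ) * (u : Matrix ι ι ℂ)ᴴ - 1) =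
      spectralRadius ℂ ((u : Matrix ι ι ℂ)ᴴ * u - 1) := by
    rw [h3, spectralRadius, spectralRadius, spectrum.units_conjugate]
  rw [h4, h5] at h6
  exact congrArg NNReal.toReal (ENNReal.coe_injective h6).symm

lemma norm_one_le {ι : Type*} [Fintype ι] [DecidableEq ι] : ‖(1 : Matrix ι ι ℂ)‖ ≤ 1 := by
  rw [← Matrix.diagonal_one, Matrix.l2_opNorm_diagonal, pi_norm_le_iff_of_nonneg zero_le_one]
  simp

lemma isUnit_of_norm_sub_one_le {ι : Type*} [Fintype ι] [DecidableEq ι] {G : Matrix ι ι ℂ}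
    {ε : ℝ} (hε : ε ≤ 1 / 2) (hG : ‖G - 1‖ ≤ ε) : IsUnit G := by
  have h : ‖1 - G‖ < 1 := by
    rw [norm_sub_rev]
    linarith
  simpa using (Units.oneSub (1 - G) h).isUnit

lemma norm_inv_le_two {ι : Type*} [Fintype ι] [DecidableEq ι] {G : Matrix ι ι ℂ}
    {ε : ℝ} (hε : ε ≤ 1 / 2) (hG : ‖G - 1‖ ≤ ε) : ‖G⁻¹‖ ≤ 2 := by
  have hu := (Matrix.isUnit_iff_isUnit_det G).1 (isUnit_of_norm_sub_one_le hε hG)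
  have h : G⁻¹ = 1 - G⁻¹ * (G - 1) := by
    rw [mul_sub, Matrix.nonsing_inv_mul _ hu]
    simp
  have h1 : ‖G⁻¹‖ ≤ 1 + ‖G⁻¹‖ * ε := by
    nth_rewrite 1 [h]
    refine (norm_sub_le _ _).trans (add_le_add norm_one_le ((norm_mul_le _ _).trans ?_))
    gcongr
  nlinarith [norm_nonneg G⁻¹]

lemma norm_inv_sub_one_le {ι : Type*} [Fintype ι] [DecidableEq ι] {G : Matrix ι ι ℂ}
    {ε : ℝ} (hε : ε ≤ 1 / 2) (hG : ‖G - 1‖ ≤ ε) : ‖G⁻¹ - 1‖ ≤ 2 * ε := by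
  have hu := (Matrix.isUnit_iff_isUnit_det G).1 (isUnit_of_norm_sub_one_le hε hG)
  have h : G⁻¹ - 1 = -(G⁻¹ * (G - 1)) := by
    rw [mul_sub, Matrix.nonsing_inv_mul _ hu]
    simp
  rw [h, norm_neg]
  refine (norm_mul_le _ _).trans ?_
  have := norm_inv_le_two hε hG
  gcongr

/-! ### Eigendecompositions of `A diag(μ) A†`. -/

lemma isUnit_diagonal_of_pos {ι : Type*} [Fintype ι] [DecidableEq ι] {μ : ι → ℝ}
    (hμ : ∀ i, 0 < μ i) : IsUnit (Matrix.diagonal fun i => (μ i : ℂ)) := by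
  rw [Matrix.isUnit_diagonal, Pi.isUnit_iff]
  exact fun i => isUnit_iff_ne_zero.2 (by exact_mod_cast (hμ i).ne')

/-- With `G = A†A` and `D = diag(μ)`, the compression `A†(A D A†)A = G D G` is invertible of size
`r`, and multiplication cannot raise the rank. This yields both `r ≤ n` and the positivity of the
leading eigenvalues. -/
lemma card_le_rank_of_isUnit_gram {n r : ℕ} {A : Matrix (Fin n) (Fin r) ℂ}
    (hG : IsUnit (Aᴴ * A)) {μ : Fin r → ℝ} (hμ : ∀ i, 0 < μ i) :
    r ≤ (A * Matrix.diagonal (fun i => (μ i : ℂ)) * Aᴴ).rank := by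
  have h : (Aᴴ * (A * Matrix.diagonal (fun i => (μ i : ℂ)) * Aᴴ) * A).rank = r := by
    have : Aᴴ * (A * Matrix.diagonal (fun i => (μ i : ℂ)) * Aᴴ) * A =
        (Aᴴ * A) * Matrix.diagonal (fun i => (μ i : ℂ)) * (Aᴴ * A) := by
      simp only [Matrix.mul_assoc]
    rw [this, Matrix.rank_of_isUnit _ ((hG.mul (isUnit_diagonal_of_pos hμ)).mul hG),
      Fintype.card_fin]
  conv_lhs => rw [← h]
  exact (Matrix.rank_mul_le_left _ _).trans (Matrix.rank_mul_le_right _ _)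

lemma IsEigendecomposition.conj_eq {n : ℕ} {T Q : Matrix (Fin n) (Fin n) ℂ} {lam : Fin n → ℝ}
    (h : IsEigendecomposition T Q lam) :
    Qᴴ * T * Q = Matrix.diagonal (fun i => (lam i : ℂ)) := by
  have hQ : Qᴴ * Q = 1 := Matrix.mem_unitaryGroup_iff'.1 h.unitary
  rw [h.eq]
  calc _ = (Qᴴ * Q) * Matrix.diagonal (fun i => (lam i : ℂ)) * (Qᴴ * Q) := by
        simp only [Matrix.mul_assoc]
    _ = _ := by rw [hQ, Matrix.one_mul, Matrix.mul_one]

open scoped ComplexOrder in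
/-- The leading eigenvalues of a positive semidefinite matrix of rank at least `r` are positive. -/
lemma IsEigendecomposition.pos {n r : ℕ} {T Q : Matrix (Fin n) (Fin n) ℂ} {lam : Fin n → ℝ}
    (h : IsEigendecomposition T Q lam) (hT : T.PosSemidef) (hr : r ≤ T.rank) (k : Fin n)
    (hk : (k : ℕ) < r) : 0 < lam k := by
  have hnonneg : ∀ i, 0 ≤ lam i := by
    have := hT.conjTranspose_mul_mul_same Q
    rw [h.conj_eq, Matrix.posSemidef_diagonal_iff] at this
    exact fun i => by simpa using this i
  by_contra hle
  -- A vanishing `lam k` kills all later eigenvalues, leaving at most `k < r` nonzero ones, against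
  -- the rank.
  have hzero : ∀ i, k ≤ i → lam i = 0 := fun i hi =>
    le_antisymm ((h.decreasing hi).trans (not_lt.1 hle)) (hnonneg i)
  have h1 : T.rank ≤ Fintype.card {i // (lam i : ℂ) ≠ 0} := by
    rw [← Matrix.rank_diagonal, h.eq]
    exact (Matrix.rank_mul_le_left _ _).trans (Matrix.rank_mul_le_right _ _)
  have h2 : Fintype.card {i // (lam i : ℂ) ≠ 0} ≤ k := by
    rw [Fintype.card_subtype, ← Fin.card_Iio k]
    refine Finset.card_le_card fun i hi => ?_
    rw [Finset.mem_Iio]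
    by_contra hki
    exact (Finset.mem_filter.1 hi).2 (by rw [hzero i (not_lt.1 hki), Complex.ofReal_zero])
  omega

open scoped ComplexOrder in
/-- The leading eigenvectors of `A diag(μ) A†` are combinations of the columns of `A`. -/
lemma exists_firstCols_eq {n r : ℕ} {A : Matrix (Fin n) (Fin r) ℂ} (hG : IsUnit (Aᴴ * A))
    {μ : Fin r → ℝ} (hμ : ∀ i, 0 < μ i) (hrn : r ≤ n) {Q : Matrix (Fin n) (Fin n) ℂ}
    {lam : Fin n → ℝ}
    (h : IsEigendecomposition (A * Matrix.diagonal (fun i => (μ i : ℂ)) * Aᴴ) Q lam) :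
    ∃ P : Matrix (Fin r) (Fin r) ℂ, firstCols hrn Q = A * P := by
  have hT : (A * Matrix.diagonal (fun i => (μ i : ℂ)) * Aᴴ).PosSemidef :=
    (Matrix.PosSemidef.diagonal fun i => by
      simpa using (hμ i).le).mul_mul_conjTranspose_same A
  have hpos := h.pos hT (card_le_rank_of_isUnit_gram hG hμ)
  have hQ : Qᴴ * Q = 1 := Matrix.mem_unitaryGroup_iff'.1 h.unitary
  let S : Matrix (Fin n) (Fin r) ℂ := (1 : Matrix (Fin n) (Fin n) ℂ).submatrix id (Fin.castLE hrn)
  have hTQ : A * Matrix.diagonal (fun i => (μ i : ℂ)) * Aᴴ * Q =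
      Q * Matrix.diagonal (fun i => (lam i : ℂ)) := by
    conv_lhs => rw [h.eq]
    rw [Matrix.mul_assoc, hQ, Matrix.mul_one]
  -- Solve `A D A† Q_r = Q_r Λ_r` for `Q_r`, where `D = diag(μ)` and `Λ_r` holds the `r` leading
  -- eigenvalues, which are invertible.
  refine ⟨Matrix.diagonal (fun i => (μ i : ℂ)) * Aᴴ * firstCols hrn Q *
    Matrix.diagonal (fun i => ((lam (Fin.castLE hrn i) : ℂ))⁻¹), ?_⟩
  have hcols : A * Matrix.diagonal (fun i => (μ i : ℂ)) * Aᴴ * firstCols hrn Q =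
      firstCols hrn Q * Matrix.diagonal (fun i => (lam (Fin.castLE hrn i) : ℂ)) := by
    ext i j
    have := congrFun (congrFun hTQ i) (Fin.castLE hrn j)
    rw [Matrix.mul_diagonal] at this ⊢
    exact this
  simp only [← Matrix.mul_assoc]
  rw [hcols, Matrix.mul_assoc, Matrix.diagonal_mul_diagonal]
  ext i j
  rw [Matrix.mul_diagonal, mul_inv_cancel₀, mul_one]
  exact_mod_cast (hpos _ (by simp)).ne'

lemma firstCols_gram {n r : ℕ} (hrn : r ≤ n) {Q : Matrix (Fin n) (Fin n) ℂ}
    (hQ : Q ∈ Matrix.unitaryGroup (Fin n) ℂ) : (firstCols hrn Q)ᴴ * firstCols hrn Q = 1 := by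
  have hQ' : Qᴴ * Q = 1 := Matrix.mem_unitaryGroup_iff'.1 hQ
  ext i j
  have := congrFun (congrFun hQ' (Fin.castLE hrn i)) (Fin.castLE hrn j)
  rw [Matrix.one_apply] at this ⊢
  simp only [Fin.castLE_inj] at this
  exact this

/-- If `A` is nearly an isometry, then the matrix expressing the leading eigenvectors of
`A diag(μ) A†` through the columns of `A` is nearly unitary. -/
theorem exists_nearly_unitary {n r : ℕ} {A : Matrix (Fin n) (Fin r) ℂ} {ε : ℝ} (hε : ε ≤ 1 / 2)
    (hA : ‖Aᴴ * A - 1‖ ≤ ε) {μ : Fin r → ℝ} (hμ : ∀ i, 0 < μ i) (hrn : r ≤ n)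
    {Q : Matrix (Fin n) (Fin n) ℂ} {lam : Fin n → ℝ}
    (h : IsEigendecomposition (A * Matrix.diagonal (fun i => (μ i : ℂ)) * Aᴴ) Q lam) :
    ∃ P : Matrix (Fin r) (Fin r) ℂ, IsUnit P ∧ firstCols hrn Q = A * P ∧
      (∀ P', firstCols hrn Q = A * P' → P' = P) ∧
      ‖Pᴴ * P - 1‖ = ‖P * Pᴴ - 1‖ ∧ ‖Pᴴ * P - 1‖ ≤ 2 * ε ∧ ‖P‖ ≤ 2 ∧ ‖P⁻¹‖ ≤ 2 := by
  have hG := isUnit_of_norm_sub_one_le hε hA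
  have hGdet := (Matrix.isUnit_iff_isUnit_det _).1 hG
  obtain ⟨P, hP⟩ := exists_firstCols_eq hG hμ hrn h
  have hgram : Pᴴ * (Aᴴ * A) * P = 1 := by
    rw [← firstCols_gram hrn h.unitary, hP, Matrix.conjTranspose_mul]
    simp only [Matrix.mul_assoc]
  have hPu : IsUnit P := IsUnit.of_mul_eq_one_right _ hgram
  have hPdet := (Matrix.isUnit_iff_isUnit_det _).1 hPu
  have hPinv : P⁻¹ = Pᴴ * (Aᴴ * A) := Matrix.inv_eq_left_inv hgram
  have hGinv : P * Pᴴ = (Aᴴ * A)⁻¹ := by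
    refine (Matrix.inv_eq_left_inv ?_).symm
    rw [Matrix.mul_assoc, ← hPinv, Matrix.mul_nonsing_inv _ hPdet]
  have hGeq : (P⁻¹)ᴴ * P⁻¹ = Aᴴ * A := by
    rw [Matrix.conjTranspose_nonsing_inv]
    conv_lhs => rw [hPinv]
    rw [← Matrix.mul_assoc, Matrix.nonsing_inv_mul _ (by
      rw [Matrix.det_conjTranspose]
      exact hPdet.star), Matrix.one_mul]
  have hnorm := norm_conjTranspose_mul_self_sub_one hPu
  refine ⟨P, hPu, hP, fun P' hP' => ?_, hnorm, ?_, ?_, ?_⟩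
  · have h1 : Aᴴ * A * P' = Aᴴ * A * P := by
      rw [Matrix.mul_assoc, Matrix.mul_assoc, ← hP, ← hP']
    simpa [← Matrix.mul_assoc, Matrix.nonsing_inv_mul _ hGdet] using
      congrArg (fun X => (Aᴴ * A)⁻¹ * X) h1
  · rw [hnorm, hGinv]
    exact norm_inv_sub_one_le hε hA
  -- By the C*-identity `‖P‖² = ‖PP†‖ = ‖G⁻¹‖`; below, likewise, `‖P⁻¹‖² = ‖G‖`.
  · have h1 : ‖P‖ * ‖P‖ ≤ 2 := by
      rw [← CStarRing.norm_self_mul_star, Matrix.star_eq_conjTranspose, hGinv]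
      exact norm_inv_le_two hε hA
    nlinarith [norm_nonneg P]
  · have h1 : ‖P⁻¹‖ * ‖P⁻¹‖ ≤ 2 := by
      rw [← Matrix.l2_opNorm_conjTranspose_mul_self, hGeq]
      calc ‖Aᴴ * A‖ = ‖(Aᴴ * A - 1) + 1‖ := by rw [sub_add_cancel]
        _ ≤ ε + 1 := (norm_add_le _ _).trans (add_le_add hA norm_one_le)
        _ ≤ 2 := by linarith
    nlinarith [norm_nonneg P⁻¹]

/-! ### The Gram matrix of the normalized Vandermonde matrix. -/

/-- The Vandermonde matrix with normalized columns. -/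
noncomputable def normVander (n : ℕ) {k : ℕ} (z : Fin k → Circle) : Matrix (Fin n) (Fin k) ℂ :=
  ((1 / √(n : ℝ) : ℝ) : ℂ) • vander n z

lemma normVander_gram (n : ℕ) {k : ℕ} (z : Fin k → Circle) :
    (normVander n z)ᴴ * normVander n z = ((1 / n : ℝ) : ℂ) • ((vander n z)ᴴ * vander n z) := by
  rw [normVander, Matrix.conjTranspose_smul, Matrix.smul_mul, Matrix.mul_smul, smul_smul]
  congr 1
  simp only [Complex.star_def, Complex.conj_ofReal]
  rw [← Complex.ofReal_mul, div_mul_div_comm, one_mul, Real.mul_self_sqrt (Nat.cast_nonneg n)]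

/-- The normalization moves a factor `n` into the weights, which is harmless because only their
positivity matters. -/
lemma toeplitz_eq_normVander {n : ℕ} (hn : 1 ≤ n) {k : ℕ} (z : Fin k → Circle) (μ : Fin k → ℝ) :
    toeplitz n z μ = normVander n z * Matrix.diagonal (fun i => ((n * μ i : ℝ) : ℂ)) *
      (normVander n z)ᴴ := by
  have hn' : (n : ℝ) ≠ 0 := by positivity
  have hd : Matrix.diagonal (fun i => ((n * μ i : ℝ) : ℂ)) =
      ((n : ℝ) : ℂ) • Matrix.diagonal (fun i => (μ i : ℂ)) := by
    ext i j
    simp [Matrix.diagonal_apply]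
  rw [hd, normVander, Matrix.conjTranspose_smul]
  simp only [Matrix.smul_mul, Matrix.mul_smul, smul_smul, Complex.star_def, Complex.conj_ofReal]
  rw [← Complex.ofReal_mul, ← Complex.ofReal_mul, toeplitz]
  have : 1 / √(n : ℝ) * (n * (1 / √(n : ℝ))) = 1 := by
    rw [mul_left_comm, div_mul_div_comm, one_mul, Real.mul_self_sqrt (Nat.cast_nonneg n)]
    field_simp
  rw [this, Complex.ofReal_one, one_smul]

lemma vander_mulVec (n : ℕ) {k : ℕ} (z : Fin k → Circle) (x : Fin k → ℂ) (j : Fin n) :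
    (vander n z *ᵥ x) j = expSum z x j := by
  simp [vander, expSum, Matrix.mulVec, dotProduct, mul_comm]

lemma re_dotProduct_vander_gram (n : ℕ) {k : ℕ} (z : Fin k → Circle) (x : Fin k → ℂ) :
    (star x ⬝ᵥ ((vander n z)ᴴ * vander n z) *ᵥ x).re =
      ∑ j ∈ Finset.range n, ‖expSum z x j‖ ^ 2 := by
  rw [← Matrix.mulVec_mulVec, Matrix.dotProduct_mulVec, ← Matrix.star_mulVec, dotProduct,
    Complex.re_sum, ← Fin.sum_univ_eq_sum_range (fun j => ‖expSum z x j‖ ^ 2)]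
  refine Finset.sum_congr rfl fun j _ => ?_
  rw [Pi.star_apply, vander_mulVec, Complex.star_def, Complex.conj_mul', ← Complex.ofReal_pow,
    Complex.ofReal_re]

/-- Vandermonde matrices with `δ`-separated nodes on the circle are well conditioned. -/
lemma norm_normVander_gram_sub_one_le {n k : ℕ} (hn1 : 1 ≤ n) (z : Fin k → Circle) {δ : ℝ}
    (hδ : 0 < δ) (hδ2 : δ ≤ 2) (hz : ∀ i j, i ≠ j → δ ≤ ‖(z i : ℂ) - z j‖) (hn : 3 / δ ≤ n) :
    ‖(normVander n z)ᴴ * normVander n z - 1‖ ≤ sieveConst / (δ * n) := by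
  have hn0 : (0 : ℝ) < n := by exact_mod_cast hn1
  have hc := three_le_sieveConst
  refine l2_opNorm_le_of_abs_re_le
    ((Matrix.isHermitian_conjTranspose_mul_self _).sub Matrix.isHermitian_one) (by positivity)
    fun x => ?_
  have hx : (star x ⬝ᵥ x).re = ∑ i, ‖x i‖ ^ 2 := by
    rw [dotProduct, Complex.re_sum]
    refine Finset.sum_congr rfl fun j _ => ?_
    rw [Pi.star_apply, Complex.star_def, Complex.conj_mul', ← Complex.ofReal_pow,
      Complex.ofReal_re]
  have h := abs_sum_expSum_sub_le z hδ hδ2 hz hn x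
  rw [Matrix.sub_mulVec, dotProduct_sub, Matrix.one_mulVec, Complex.sub_re, hx, normVander_gram,
    Matrix.smul_mulVec, dotProduct_smul, smul_eq_mul, Complex.re_ofReal_mul,
    re_dotProduct_vander_gram]
  set s := ∑ j ∈ Finset.range n, ‖expSum z x j‖ ^ 2
  set E := ∑ i, ‖x i‖ ^ 2
  calc |1 / (n : ℝ) * s - E| = 1 / n * |s - n * E| := by
        rw [← abs_of_pos (by positivity : (0 : ℝ) < 1 / n), ← abs_mul,
          abs_of_pos (by positivity : (0 : ℝ) < 1 / n)]
        congr 1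
        field_simp
    _ ≤ 1 / n * (sieveConst / δ * E) := by gcongr
    _ = _ := by field_simp

lemma norm_normVander_gram_sub_one_of_card_eq_one {n : ℕ} (hn : 1 ≤ n) (z : Fin 1 → Circle) :
    ‖(normVander n z)ᴴ * normVander n z - 1‖ ≤ 0 := by
  have hn' : (n : ℂ) ≠ 0 := by exact_mod_cast (by omega : n ≠ 0)
  have h : (normVander n z)ᴴ * normVander n z = 1 := by
    rw [normVander_gram]
    ext i j
    rw [Subsingleton.elim i 0, Subsingleton.elim j 0]
    simp [vander, Matrix.mul_apply, ← mul_pow, Complex.conj_mul', Circle.norm_coe, hn']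
  rw [h, sub_self, norm_zero]

/-! ### From the extended-real gap to a real separation. -/

lemma gap_le_edist {r d : ℕ} (hrd : r ≤ d) (z : Fin d → Circle) {i j : Fin r} (hij : i ≠ j) :
    gap r z ≤ edist (zdom hrd z i : ℂ) (zdom hrd z j : ℂ) :=
  iInf₂_le_of_le (Fin.castLE hrd i) (Fin.castLE hrd j) <|
    iInf₂_le (by simp) (fun h => hij (Fin.castLE_injective hrd h))

lemma edist_circle_le_two (z w : Circle) : edist (z : ℂ) (w : ℂ) ≤ 2 := by
  rw [edist_dist, dist_eq_norm]
  refine ENNReal.ofReal_le_of_le_toReal ((norm_sub_le _ _).trans ?_)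
  rw [Circle.norm_coe, Circle.norm_coe]
  norm_num

/-- If `d ≥ 2`, the first two nodes form an admissible pair at distance at most `2`; otherwise no
pair exists. -/
lemma gap_le_two_or_eq_one {r d : ℕ} (hr : 1 ≤ r) (hrd : r ≤ d) (z : Fin d → Circle) :
    gap r z ≤ 2 ∨ r = 1 ∧ gap r z = ⊤ := by
  rcases Nat.lt_or_ge 1 d with hd | hd
  · left
    have h : (⟨0, by omega⟩ : Fin d) ≠ ⟨1, hd⟩ := by simp
    exact (iInf₂_le_of_le ⟨0, by omega⟩ ⟨1, hd⟩ (iInf₂_le (Nat.lt_of_succ_le hr) h)).trans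
      (edist_circle_le_two _ _)
  · right
    have : Subsingleton (Fin d) := Fin.subsingleton_iff_le_one.2 hd
    refine ⟨by omega, ?_⟩
    simp only [gap, iInf_eq_top]
    exact fun i j _ h => (h (Subsingleton.elim _ _)).elim

/-- The normalized Vandermonde matrix of the dominant nodes is nearly an isometry. -/
lemma exists_gram_bound {n r d : ℕ} (hn : 1 ≤ n) (hr : 1 ≤ r) (hrd : r ≤ d) (z : Fin d → Circle)
    (hz : 0 < gap r z) (hc : ENNReal.ofReal (2 * sieveConst) / gap r z ≤ n) :
    ∃ ε : ℝ, ε ≤ 1 / 2 ∧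
      ‖(normVander n (zdom hrd z))ᴴ * normVander n (zdom hrd z) - 1‖ ≤ ε ∧
      ENNReal.ofReal (2 * ε) ≤ ENNReal.ofReal (2 * sieveConst) / (gap r z * n) := by
  have hs := three_le_sieveConst
  have hn0 : (0 : ℝ) < n := by exact_mod_cast hn
  rcases gap_le_two_or_eq_one hr hrd z with hgap | ⟨rfl, -⟩
  · have htop : gap r z ≠ ⊤ := ne_top_of_le_ne_top ENNReal.ofNat_ne_top hgap
    obtain ⟨δ, hδ⟩ : ∃ δ : ℝ, δ = (gap r z).toReal := ⟨_, rfl⟩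
    have hgapδ : gap r z = ENNReal.ofReal δ := by rw [hδ, ENNReal.ofReal_toReal htop]
    have hδ0 : 0 < δ := hδ ▸ ENNReal.toReal_pos hz.ne' htop
    have hδ2 : δ ≤ 2 := hδ ▸ ENNReal.toReal_le_of_le_ofReal (by norm_num) (by simpa using hgap)
    have hsep : ∀ i j, i ≠ j → δ ≤ ‖(zdom hrd z i : ℂ) - zdom hrd z j‖ := fun i j hij => by
      have := gap_le_edist hrd z hij
      rwa [hgapδ, edist_dist, ENNReal.ofReal_le_ofReal_iff dist_nonneg, dist_eq_norm] at this
    rw [hgapδ, ← ENNReal.ofReal_natCast, ← ENNReal.ofReal_div_of_pos hδ0,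
      ENNReal.ofReal_le_ofReal_iff hn0.le] at hc
    have hn3 : 3 / δ ≤ n := le_trans (by gcongr; linarith) hc
    -- The threshold `2 * sieveConst` is exactly what makes this error at most `1/2`; the factor `2`
    -- in the final bound comes from inverting the Gram matrix.
    refine ⟨sieveConst / (δ * n), ?_,
      norm_normVander_gram_sub_one_le hn _ hδ0 hδ2 hsep hn3, le_of_eq ?_⟩
    · rw [div_le_iff₀ hδ0] at hc
      rw [div_le_div_iff₀ (by positivity) two_pos]
      linarith
    · rw [hgapδ, ← ENNReal.ofReal_natCast, ← ENNReal.ofReal_mul hδ0.le,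
        ← ENNReal.ofReal_div_of_pos (by positivity), mul_div_assoc]
  -- A single normalized column has Gram matrix exactly `1`, so the zero error that an infinite gap
  -- demands is available.
  · exact ⟨0, by norm_num, norm_normVander_gram_sub_one_of_card_eq_one hn _, by simp⟩

end Esprit

theorem lemma1p5 :
    ∃ c : ℝ, 0 < c ∧ ∃ C : ℝ, 0 < C ∧
      ∀ (n r d : ℕ) (_ : 1 ≤ n) (_ : 1 ≤ r) (hrd : r ≤ d)
        (z : Fin d → Circle) (_ : 0 < Esprit.gap r z)
        (μ : Fin r → ℝ) (_ : ∀ i, 0 < μ i)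
        (_ : ENNReal.ofReal c / Esprit.gap r z ≤ (n : ℝ≥0∞)),
        ∃ hrn : r ≤ n,
          ∀ (Q : Matrix (Fin n) (Fin n) ℂ) (lam : Fin n → ℝ),
            Esprit.IsEigendecomposition (Esprit.toeplitz n (Esprit.zdom hrd z) μ) Q lam →
            ∃ P : Matrix (Fin r) (Fin r) ℂ,
              IsUnit P ∧
              Esprit.firstCols hrn Q =
                ((1 / √(n : ℝ) : ℝ) : ℂ) • (Esprit.vander n (Esprit.zdom hrd z) * P) ∧
              (∀ P' : Matrix (Fin r) (Fin r) ℂ,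
                Esprit.firstCols hrn Q =
                  ((1 / √(n : ℝ) : ℝ) : ℂ) • (Esprit.vander n (Esprit.zdom hrd z) * P') →
                P' = P) ∧
              ‖Pᴴ * P - 1‖ = ‖P * Pᴴ - 1‖ ∧
              ENNReal.ofReal ‖Pᴴ * P - 1‖ ≤
                ENNReal.ofReal C / (Esprit.gap r z * (n : ℝ≥0∞)) ∧
              ‖P‖ ≤ C ∧ ‖P⁻¹‖ ≤ C := by
  have hs := Esprit.three_le_sieveConst
  refine ⟨2 * Esprit.sieveConst, by positivity, 2 * Esprit.sieveConst, by positivity, ?_⟩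
  intro n r d hn hr hrd z hz μ hμ hc
  obtain ⟨ε, hε, hA, hbound⟩ := Esprit.exists_gram_bound hn hr hrd z hz hc
  have hG := Esprit.isUnit_of_norm_sub_one_le hε hA
  have hrn : r ≤ n := by
    have h := (Esprit.card_le_rank_of_isUnit_gram hG hμ).trans (Matrix.rank_le_card_height _)
    rwa [Fintype.card_fin] at h
  refine ⟨hrn, fun Q lam hQ => ?_⟩
  rw [Esprit.toeplitz_eq_normVander hn] at hQ
  obtain ⟨P, hPu, hP, huniq, hnorm, hle, hP2, hPinv⟩ := Esprit.exists_nearly_unitary hε hA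
    (fun i => mul_pos (by exact_mod_cast hn) (hμ i)) hrn hQ
  simp only [Esprit.normVander, Matrix.smul_mul] at hP huniq
  exact ⟨P, hPu, hP, huniq, hnorm, (ENNReal.ofReal_le_ofReal hle).trans hbound,
    hP2.trans (by linarith), hPinv.trans (by linarith)⟩
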